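/- Let $r\ge 1$, let $A_n$ ($n\ge 1$) be nonsingular and $B_n$ ($n\ge 0$) Hermitian complex $r\times r$ matrices, and let $P_n$ be the $r\times r$ matrix-valued polynomials generated by $$xP_n(x)=A_{n+1}P_{n+1}(x)+B_nP_n(x)+A_n^*P_{n-1}(x),\qquad n\ge 0,$$ with $P_{-1}\equiv 0$ and $P_0\equiv I_r$ (so that the value of $A_0$ plays no role). Assume that $A_n\to A$ and $B_n\to B$ as $n\to\infty$, where $A$ is nonsingular (and $B$ is Hermitian). Let $M>0$ be such that for every $n$ all the zeros of $\det P_n$ lie in the real interval $[-M,M]$. For $x\in\mathbb C$ let $z_1(x),\dots,z_{2r}(x)$ be the roots $z$ of $$\det\left(zA^*+B+z^{-1}A-xI_r\right)=0,$$ counted with multiplicity (as zeros of the polynomial $z^r\det(zA^*+B+z^{-1}A-xI_r)$ in $z$) and labelled so that $|z_1(x)|\le |z_2(x)|\le\dots\le|z_{2r}(x)|$, roots of equal modulus being labelled in an arbitrary order. Then $$\lim_{n\to\infty}\frac{\det P_n(x)}{\det P_{n+1}(x)}=z_1(x)\cdots z_r(x)$$ uniformly on compact subsets of $\mathbb C\setminus[-M,M]$.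 -/

import Mathlib

open Polynomial

/-- The preceding term of a sequence, with the convention that the term of index `-1` is `0`. -/
def MatrixOP.prev {α : Type*} [Zero α] (P : ℕ → α) : ℕ → α
  | 0 => 0
  | n + 1 => P n

/-- `P 0, P 1, …` are the `r × r` matrix-valued polynomials generated by the recurrence
`x P_n(x) = A_{n+1} P_{n+1}(x) + B_n P_n(x) + A_n^* P_{n-1}(x)` for `n ≥ 0`,
with `P_{-1} = 0` and `P_0 = I`. The value `A 0` is irrelevant, as it only multiplies `P_{-1}`. -/
structure MatrixOP.Generates {r : ℕ} (A B : ℕ → Matrix (Fin r) (Fin r) ℂ)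
    (P : ℕ → Matrix (Fin r) (Fin r) ℂ[X]) : Prop where
  initial : P 0 = 1
  recurrence : ∀ n : ℕ, (X : ℂ[X]) • P n =
    (A (n + 1)).map C * P (n + 1) + (B n).map C * P n
      + (A n).conjTranspose.map C * MatrixOP.prev P n

/-- The real interval `[-M, M]` as a subset of the complex plane. -/
def MatrixOP.interval (M : ℝ) : Set ℂ := (fun t : ℝ => (t : ℂ)) '' Set.Icc (-M) M

/-- The function `f(z,x) = det (z A^* + B + z⁻¹ A - x I)`, for `z ≠ 0`. -/
noncomputable def MatrixOP.f {r : ℕ} (A B : Matrix (Fin r) (Fin r) ℂ) (z x : ℂ) : ℂ :=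
  (z • A.conjTranspose + B + z⁻¹ • A - x • (1 : Matrix (Fin r) (Fin r) ℂ)).det

/-- The polynomial `Z^r f(Z,x)` in the variable `Z`, for fixed `x`:
`det (Z² A^* + Z (B - x I) + A)`. See `MatrixOP.eval_fPoly`. -/
noncomputable def MatrixOP.fPoly {r : ℕ} (A B : Matrix (Fin r) (Fin r) ℂ) (x : ℂ) : ℂ[X] :=
  ((X ^ 2 : ℂ[X]) • A.conjTranspose.map C
    + (X : ℂ[X]) • (B - x • (1 : Matrix (Fin r) (Fin r) ℂ)).map C + A.map C).det

theorem MatrixOP.eval_fPoly {r : ℕ} (A B : Matrix (Fin r) (Fin r) ℂ) (x z : ℂ) (hz : z ≠ 0) :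
    (MatrixOP.fPoly A B x).eval z = z ^ r * MatrixOP.f A B z x := by
  have h : z ^ r * MatrixOP.f A B z x = (z • (z • A.conjTranspose + B + z⁻¹ • A
      - x • (1 : Matrix (Fin r) (Fin r) ℂ))).det := by
    rw [Matrix.det_smul, Fintype.card_fin, MatrixOP.f]
  rw [h, MatrixOP.fPoly, ← Polynomial.coe_evalRingHom, RingHom.map_det]
  congr 1
  ext i j
  simp
  field_simp
  ring

/-- `ζ 0, …, ζ (2r-1)` is a labelling of all the roots `z` of `f(z,x) = 0`, repeated according to
multiplicity (the multiplicity of `z` as a zero of `Z^r f(Z,x)`), by nondecreasing modulus;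
roots of equal modulus may be labelled in any order. -/
structure MatrixOP.IsRootLabelling {r : ℕ} (A B : Matrix (Fin r) (Fin r) ℂ) (x : ℂ)
    (ζ : Fin (2 * r) → ℂ) : Prop where
  roots_eq : (Finset.univ : Finset (Fin (2 * r))).val.map ζ = (MatrixOP.fPoly A B x).roots
  norm_mono : Monotone fun k => ‖ζ k‖

/-! Put W_n(x) = P_n (A_{n+1} P_{n+1})⁻¹, so that det P_n / det P_{n+1} = det W_n · det A_{n+1}. It
suffices that W_n converge uniformly to some W and that det (W A) be the product of the r smallest
roots.

Eigenvalues of the truncated Hermitian block Jacobi matrices are zeros of the det P_k, so at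
distance δ from [-M, M] the resolvents are bounded by 1/δ. This bounds W_n and forces the partial
sums of ‖P_j v‖² to grow geometrically, whence the products of consecutive A_i W_i decay
geometrically (`IsControlled.norm_propagator_sq_le`).

W_n obeys a Riccati recurrence (`IsControlled.riccati`). Subtracting a shifted copy gives a linear
recurrence for W_n - W_{n+m} with small forcing, driven by those decaying products; hence W_n is
uniformly Cauchy.

The limit solves (x - B - A* W A) W = 1, which factors the root polynomial as det (Z A* - W⁻¹) · det
(Z - W A) (`fPoly_eq_mul_charpoly`). As (A W)^k and (W A*)^k tend to 0, the second factor has its r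
roots inside the unit circle and the first has its roots outside. -/

namespace MatrixOP

/-! ### Truncated block Jacobi operators and their resolvent bound. -/

section Jacobi

variable {E : Type*} [NormedAddCommGroup E]

/-- Extension of a finite sequence by zero. -/
def zeroExtend {k : ℕ} (u : PiLp 2 (fun _ : Fin k => E)) (n : ℕ) : E :=
  if h : n < k then u ⟨n, h⟩ else 0

theorem zeroExtend_coe {k : ℕ} (u : PiLp 2 (fun _ : Fin k => E)) (i : Fin k) :
    zeroExtend u i = u i := by simp [zeroExtend]

theorem zeroExtend_self {k : ℕ} (u : PiLp 2 (fun _ : Fin k => E)) : zeroExtend u k = 0 := by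
  simp [zeroExtend]

theorem zeroExtend_add {k : ℕ} (u v : PiLp 2 (fun _ : Fin k => E)) (n : ℕ) :
    zeroExtend (u + v) n = zeroExtend u n + zeroExtend v n := by
  by_cases h : n < k <;> simp [zeroExtend, h]

variable [InnerProductSpace ℂ E]

theorem zeroExtend_smul {k : ℕ} (c : ℂ) (u : PiLp 2 (fun _ : Fin k => E)) (n : ℕ) :
    zeroExtend (c • u) n = c • zeroExtend u n := by
  by_cases h : n < k <;> simp [zeroExtend, h]

variable [FiniteDimensional ℂ E]

/-- The action of the block Jacobi matrix with off-diagonal blocks `a` and diagonal blocks `b` on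
sequences of vectors. -/
noncomputable def jacobi (a b : ℕ → E →L[ℂ] E) (u : ℕ → E) (n : ℕ) : E :=
  a (n + 1) (u (n + 1)) + b n (u n) + (a n).adjoint (prev u n)

/-- The truncated block Jacobi matrix. -/
noncomputable def truncJacobi (a b : ℕ → E →L[ℂ] E) (k : ℕ) :
    PiLp 2 (fun _ : Fin k => E) →ₗ[ℂ] PiLp 2 (fun _ : Fin k => E) where
  toFun u := WithLp.toLp 2 fun i => jacobi a b (zeroExtend u) i
  map_add' u v := by
    ext i
    rcases i with ⟨_ | n, hn⟩ <;> simp [jacobi, prev, zeroExtend_add] <;> abel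
  map_smul' c u := by
    ext i
    rcases i with ⟨_ | n, hn⟩ <;> simp [jacobi, prev, zeroExtend_smul]

theorem truncJacobi_apply (a b : ℕ → E →L[ℂ] E) (k : ℕ) (u : PiLp 2 (fun _ : Fin k => E))
    (i : Fin k) : truncJacobi a b k u i = jacobi a b (zeroExtend u) i := rfl

/-- Discrete Green identity: the off-diagonal terms telescope, leaving only the boundary at `n`.
That boundary vanishes when `u n = w n = 0`, so truncation preserves symmetry. -/
theorem jacobi_green (a b : ℕ → E →L[ℂ] E) (hb : ∀ n, (b n : E →ₗ[ℂ] E).IsSymmetric)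
    (u w : ℕ → E) (n : ℕ) :
    ∑ i ∈ Finset.range n, (inner ℂ (jacobi a b u i) (w i) - inner ℂ (u i) (jacobi a b w i)) =
      inner ℂ (a n (u n)) (prev w n) - inner ℂ (prev u n) (a n (w n)) := by
  induction n with
  | zero => simp [prev]
  | succ n ih =>
    rw [Finset.sum_range_succ, ih]
    have h := hb n (u n) (w n)
    simp only [ContinuousLinearMap.coe_coe] at h
    simp only [jacobi, inner_add_left, inner_add_right, ContinuousLinearMap.adjoint_inner_left,
      ContinuousLinearMap.adjoint_inner_right, h, prev]
    ring

theorem truncJacobi_isSymmetric (a b : ℕ → E →L[ℂ] E)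
    (hb : ∀ n, (b n : E →ₗ[ℂ] E).IsSymmetric) (k : ℕ) : (truncJacobi a b k).IsSymmetric := by
  intro u w
  have h := jacobi_green a b hb (zeroExtend u) (zeroExtend w) k
  rw [← Fin.sum_univ_eq_sum_range (fun i => inner ℂ (jacobi a b (zeroExtend u) i) (zeroExtend w i)
    - inner ℂ (zeroExtend u i) (jacobi a b (zeroExtend w) i))] at h
  simp only [zeroExtend_coe, zeroExtend_self, map_zero, inner_zero_left, inner_zero_right,
    sub_zero, Finset.sum_sub_distrib, sub_eq_zero] at h
  simpa only [PiLp.inner_apply, truncJacobi_apply] using h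

/-- A lower bound for `x - T` in terms of the distance from `x` to the eigenvalues of `T`. -/
theorem _root_.LinearMap.IsSymmetric.mul_norm_le_norm_smul_sub {F : Type*} [NormedAddCommGroup F]
    [InnerProductSpace ℂ F] [FiniteDimensional ℂ F] {T : F →ₗ[ℂ] F} (hT : T.IsSymmetric)
    {x : ℂ} {δ : ℝ} (hδ : 0 ≤ δ)
    (h : ∀ (t : ℂ) (v : F), v ≠ 0 → T v = t • v → δ ≤ ‖x - t‖) (u : F) :
    δ ^ 2 * ‖u‖ ^ 2 ≤ ‖x • u - T u‖ ^ 2 := by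
  set e := hT.eigenvectorBasis rfl
  rw [← e.sum_sq_norm_inner_right u, ← e.sum_sq_norm_inner_right (x • u - T u), Finset.mul_sum]
  refine Finset.sum_le_sum fun i _ => ?_
  have h1 : inner ℂ (e i) (x • u - T u) = (x - hT.eigenvalues rfl i) * inner ℂ (e i) u := by
    rw [inner_sub_right, inner_smul_right, ← hT (e i) u, hT.apply_eigenvectorBasis,
      inner_smul_left]
    simp [e]
    ring
  have h2 := h (hT.eigenvalues rfl i) (e i) (e.orthonormal.ne_zero i)
    (hT.apply_eigenvectorBasis rfl i)
  rw [h1, norm_mul, mul_pow]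
  gcongr

/-- Cutting `u` off at `k` gives a vector `v` for which `x • v - T v`, with `T` the truncated
operator, is supported in the last block, where it equals `a k (u k)`. The spectral lower bound for
`x - T` then applies. -/
theorem sum_norm_sq_le_of_jacobi {a b : ℕ → E →L[ℂ] E}
    (hb : ∀ n, (b n : E →ₗ[ℂ] E).IsSymmetric) {x : ℂ} {δ : ℝ} (hδ : 0 ≤ δ) (k : ℕ)
    (h : ∀ (t : ℂ) (w : ℕ → E), (∃ n < k, w n ≠ 0) → w k = 0 →
      (∀ n < k, jacobi a b w n = t • w n) → δ ≤ ‖x - t‖)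
    {u : ℕ → E} (hu : ∀ n < k, jacobi a b u n = x • u n) :
    δ ^ 2 * ∑ j ∈ Finset.range k, ‖u j‖ ^ 2 ≤ ‖a k (u k)‖ ^ 2 := by
  let v : PiLp 2 (fun _ : Fin k => E) := WithLp.toLp 2 fun i => u i
  have hv : ∀ n < k, zeroExtend v n = u n := fun n hn => by simp [zeroExtend, hn, v]
  have key := (truncJacobi_isSymmetric a b hb k).mul_norm_le_norm_smul_sub (x := x) hδ
    (fun t w hw ht => h t (zeroExtend w) (by
      by_contra! hc
      exact hw (by ext i; simpa [zeroExtend_coe] using hc i i.2)) (zeroExtend_self w)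
      (fun n hn => by
        rw [← truncJacobi_apply a b k w ⟨n, hn⟩, ht]
        simp [zeroExtend, hn])) v
  rw [PiLp.norm_sq_eq_of_L2, PiLp.norm_sq_eq_of_L2] at key
  have e1 : ∑ i : Fin k, ‖v i‖ ^ 2 = ∑ j ∈ Finset.range k, ‖u j‖ ^ 2 :=
    Fin.sum_univ_eq_sum_range (fun j => ‖u j‖ ^ 2) k
  rw [e1] at key
  refine key.trans ?_
  have hprev : ∀ n < k, prev (zeroExtend v) n = prev u n := by
    rintro (_ | n) hn
    · rfl
    · exact hv n (by omega)
  have e2 : ∀ i : Fin k, ‖(x • v - truncJacobi a b k v) i‖ ^ 2 =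
      (fun j => if j + 1 = k then ‖a k (u k)‖ ^ 2 else 0) (i : ℕ) := by
    rintro ⟨n, hn⟩
    have h0 : (x • v - truncJacobi a b k v) ⟨n, hn⟩ =
        a (n + 1) (u (n + 1)) - a (n + 1) (zeroExtend v (n + 1)) := by
      rw [PiLp.sub_apply, PiLp.smul_apply, truncJacobi_apply]
      change x • u n - _ = _
      rw [← hu n hn]
      simp only [jacobi, hprev n hn, hv n hn]
      abel
    rw [h0]
    by_cases hk : n + 1 = k
    · subst hk
      simp [zeroExtend_self]
    · rw [hv (n + 1) (by omega)]
      simp [hk]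
  rw [Finset.sum_congr rfl fun i _ => e2 i,
    Fin.sum_univ_eq_sum_range (fun j => if j + 1 = k then ‖a k (u k)‖ ^ 2 else 0)]
  rcases k with _ | k
  · simp
  · simp

end Jacobi

end MatrixOP

/-! ### Matrix polynomials as solutions of the recurrence. -/

namespace MatrixOP

open scoped Matrix.Norms.L2Operator Matrix

variable {r : ℕ}

theorem norm_sq_le_of_forall {T : Matrix (Fin r) (Fin r) ℂ} {c : ℝ} (hc : 0 ≤ c)
    (h : ∀ v, ‖Matrix.toEuclideanCLM (𝕜 := ℂ) T v‖ ^ 2 ≤ c * ‖v‖ ^ 2) : ‖T‖ ^ 2 ≤ c := by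
  rw [Matrix.cstar_norm_def]
  have : ‖Matrix.toEuclideanCLM (𝕜 := ℂ) T‖ ≤ √c := by
    refine ContinuousLinearMap.opNorm_le_bound _ (Real.sqrt_nonneg _) fun v => ?_
    refine abs_le_of_sq_le_sq' ?_ (by positivity) |>.2
    rw [mul_pow, Real.sq_sqrt hc]
    exact h v
  calc _ ≤ √c ^ 2 := by gcongr
    _ = c := Real.sq_sqrt hc

theorem norm_mul_inv_sq_le {T R : Matrix (Fin r) (Fin r) ℂ} (hR : IsUnit R) {c : ℝ} (hc : 0 ≤ c)
    (h : ∀ v, ‖Matrix.toEuclideanCLM (𝕜 := ℂ) T v‖ ^ 2 ≤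
      c * ‖Matrix.toEuclideanCLM (𝕜 := ℂ) R v‖ ^ 2) : ‖T * R⁻¹‖ ^ 2 ≤ c := by
  refine norm_sq_le_of_forall hc fun v => ?_
  have := h (Matrix.toEuclideanCLM (𝕜 := ℂ) R⁻¹ v)
  rwa [← mul_apply_eq_comp, ← mul_apply_eq_comp, ← map_mul, ← map_mul,
    Matrix.mul_nonsing_inv _ ((Matrix.isUnit_iff_isUnit_det _).1 hR), map_one,
    one_apply_eq_self] at this

/-- The sequence `p` solves the three-term recurrence at the point `x`. -/
structure IsSolution (A B : ℕ → Matrix (Fin r) (Fin r) ℂ) (x : ℂ)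
    (p : ℕ → Matrix (Fin r) (Fin r) ℂ) : Prop where
  initial : p 0 = 1
  recurrence : ∀ n : ℕ, x • p n =
    A (n + 1) * p (n + 1) + B n * p n + (A n)ᴴ * prev p n

theorem Generates.isSolution {A B : ℕ → Matrix (Fin r) (Fin r) ℂ}
    {P : ℕ → Matrix (Fin r) (Fin r) ℂ[X]} (hP : Generates A B P) (x : ℂ) :
    IsSolution A B x fun n => (P n).map (eval x) where
  initial := by
    rw [hP.initial]
    ext i j
    by_cases h : i = j <;> simp [Matrix.one_apply, h]
  recurrence n := by
    have hC : ∀ T : Matrix (Fin r) (Fin r) ℂ, (T.map C).map (eval x) = T := fun T => by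
      ext i j; simp
    have hmul : ∀ S T : Matrix (Fin r) (Fin r) ℂ[X],
        (S * T).map (eval x) = S.map (eval x) * T.map (eval x) := fun S T =>
      Matrix.map_mul (f := evalRingHom x)
    have hadd : ∀ S T : Matrix (Fin r) (Fin r) ℂ[X],
        (S + T).map (eval x) = S.map (eval x) + T.map (eval x) := fun S T =>
      Matrix.map_add _ (fun _ _ => eval_add) _ _
    have h := congrArg (fun T => T.map (eval x)) (hP.recurrence n)
    simp only [hmul, hadd, hC] at h
    have h1 : ((X : ℂ[X]) • P n).map (eval x) = x • (P n).map (eval x) := by ext i j; simp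
    have h2 : (prev P n).map (eval x) = prev (fun n => (P n).map (eval x)) n := by
      cases n with
      | zero => ext i j; simp [prev]
      | succ n => rfl
    rw [← h1, h, h2]

theorem eval_det (T : Matrix (Fin r) (Fin r) ℂ[X]) (x : ℂ) :
    T.det.eval x = (T.map (eval x)).det :=
  RingHom.map_det (evalRingHom x) T

/-- A vector solution of the recurrence is generated by its initial value. -/
theorem IsSolution.eq_apply {A B p : ℕ → Matrix (Fin r) (Fin r) ℂ} {x : ℂ}
    (hp : IsSolution A B x p) (hA : ∀ n, 1 ≤ n → IsUnit (A n)) {k : ℕ}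
    {w : ℕ → EuclideanSpace ℂ (Fin r)}
    (hw : ∀ n < k, jacobi (fun n => Matrix.toEuclideanCLM (𝕜 := ℂ) (A n))
      (fun n => Matrix.toEuclideanCLM (𝕜 := ℂ) (B n)) w n = x • w n) :
    ∀ n ≤ k, w n = Matrix.toEuclideanCLM (𝕜 := ℂ) (p n) (w 0) := by
  have hstep : ∀ n < k, w n = Matrix.toEuclideanCLM (𝕜 := ℂ) (p n) (w 0) →
      prev w n = Matrix.toEuclideanCLM (𝕜 := ℂ) (prev p n) (w 0) →
      w (n + 1) = Matrix.toEuclideanCLM (𝕜 := ℂ) (p (n + 1)) (w 0) := by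
    intro n hn h1 h2
    have h3 := congrArg (fun T => Matrix.toEuclideanCLM (𝕜 := ℂ) T (w 0)) (hp.recurrence n)
    have h4 := hw n hn
    simp only [map_add, map_mul, map_smul, add_apply,
      mul_apply_eq_comp, smul_apply] at h3
    rw [jacobi, h1, h2, h3, ← ContinuousLinearMap.star_eq_adjoint, ← map_star,
      Matrix.star_eq_conjTranspose, add_left_inj, add_left_inj] at h4
    have h5 := congrArg (Matrix.toEuclideanCLM (𝕜 := ℂ) (A (n + 1))⁻¹) h4
    simpa only [← mul_apply_eq_comp, ← map_mul, ← mul_assoc, Matrix.nonsing_inv_mul _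
      ((Matrix.isUnit_iff_isUnit_det _).1 (hA (n + 1) (by omega))), map_one,
      one_apply_eq_self, one_mul] using h5
  intro n
  induction n using Nat.strong_induction_on with
  | _ n ih =>
    intro hn
    cases n with
    | zero => simp [hp.initial]
    | succ n =>
      refine hstep n hn (ih n (by omega) (by omega)) ?_
      cases n with
      | zero => simp [prev]
      | succ n => exact ih n (by omega) (by omega)

/-- An eigenvector of the truncation at `t` is generated by a nonzero initial block that `P k` at
`t` annihilates, so `t` is a zero of `(P k).det` and lies in `S`. -/
theorem Generates.sum_norm_sq_le {A B : ℕ → Matrix (Fin r) (Fin r) ℂ}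
    {P : ℕ → Matrix (Fin r) (Fin r) ℂ[X]} (hP : Generates A B P)
    (hA : ∀ n, 1 ≤ n → IsUnit (A n)) (hB : ∀ n, (B n).IsHermitian) {S : Set ℂ}
    (hzeros : ∀ (n : ℕ) (x : ℂ), (P n).det.IsRoot x → x ∈ S) {x : ℂ} {δ : ℝ} (hδ : 0 ≤ δ)
    (hx : ∀ t ∈ S, δ ≤ ‖x - t‖) (k : ℕ) (v : EuclideanSpace ℂ (Fin r)) :
    δ ^ 2 * ∑ j ∈ Finset.range k, ‖Matrix.toEuclideanCLM (𝕜 := ℂ) ((P j).map (eval x)) v‖ ^ 2 ≤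
      ‖Matrix.toEuclideanCLM (𝕜 := ℂ) (A k * (P k).map (eval x)) v‖ ^ 2 := by
  rw [map_mul, mul_apply_eq_comp]
  refine sum_norm_sq_le_of_jacobi (x := x) (b := fun n => Matrix.toEuclideanCLM (𝕜 := ℂ) (B n))
    (a := fun n => Matrix.toEuclideanCLM (𝕜 := ℂ) (A n))
    (u := fun n => Matrix.toEuclideanCLM (𝕜 := ℂ) ((P n).map (eval x)) v) ?_ hδ k ?_ ?_
  · intro n
    rw [← ContinuousLinearMap.isSelfAdjoint_iff_isSymmetric]
    exact IsSelfAdjoint.map (f := Matrix.toEuclideanCLM (𝕜 := ℂ)) (hB n)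
  · intro t w ⟨n, hn, hwn⟩ hwk hw
    have hsol := (hP.isSolution t).eq_apply hA hw
    refine hx t (hzeros k t ?_)
    rw [IsRoot, eval_det, ← Matrix.exists_mulVec_eq_zero_iff]
    refine ⟨(w 0).ofLp, fun h0 => hwn ?_, ?_⟩
    · rw [hsol n hn.le, show w 0 = 0 from by ext i; exact congrFun h0 i, map_zero]
    · rw [← Matrix.ofLp_toEuclideanCLM, ← hsol k le_rfl, hwk]
      rfl
  · intro n _
    have h3 := congrArg (fun T => Matrix.toEuclideanCLM (𝕜 := ℂ) T v)
      ((hP.isSolution x).recurrence n)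
    simp only [map_add, map_mul, map_smul, add_apply,
      mul_apply_eq_comp, smul_apply] at h3
    rw [h3, jacobi, ← ContinuousLinearMap.star_eq_adjoint, ← map_star,
      Matrix.star_eq_conjTranspose]
    congr 2
    cases n with
    | zero => simp [prev]
    | succ n => rfl

/-- If the partial sums of a nonnegative sequence are controlled by the next term,
they grow geometrically. -/
theorem sum_range_le_pow_mul {f : ℕ → ℝ} {a δ : ℝ} (ha : 0 < a)
    (h : ∀ k, δ ^ 2 * ∑ j ∈ Finset.range k, f j ≤ a ^ 2 * f k) (m i : ℕ) :
    ∑ j ∈ Finset.range m, f j ≤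
      (a ^ 2 / (a ^ 2 + δ ^ 2)) ^ i * ∑ j ∈ Finset.range (m + i), f j := by
  induction i with
  | zero => simp
  | succ i ih =>
    refine ih.trans ?_
    rw [pow_succ _ i, mul_assoc]
    gcongr
    -- Adding the next term multiplies the partial sum by at least `1 + δ² / a²`, the inverse of the
    -- ratio.
    rw [← add_assoc, Finset.sum_range_succ, div_mul_eq_mul_div, le_div_iff₀ (by positivity)]
    linarith [h (m + i)]

end MatrixOP

/-! ### The Riccati recurrence and geometric decay of propagators. -/

namespace MatrixOP

open scoped Matrix.Norms.L2Operator Matrix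

/-- Noncommutative variation of constants: `l m n` is `U (n-1) ⋯ U m` and `s m n` is `V m ⋯ V
(n-1)`. -/
theorem iterate_two_sided {R : Type*} [Ring R] {D F U V : ℕ → R} {l s : ℕ → ℕ → R}
    (hD : ∀ n, D (n + 1) = U n * D n * V n + F n)
    (hl : ∀ n, l n n = 1) (hl' : ∀ m k, l m (m + k + 1) = U (m + k) * l m (m + k))
    (hs : ∀ n, s n n = 1) (hs' : ∀ m k, s m (m + k + 1) = s m (m + k) * V (m + k)) (n k : ℕ) :
    D (n + k) = l n (n + k) * D n * s n (n + k) +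
      ∑ i ∈ Finset.range k, l (n + i + 1) (n + k) * F (n + i) * s (n + i + 1) (n + k) := by
  induction k with
  | zero => simp [hl, hs]
  | succ k ih =>
    rw [← add_assoc, hD, ih, Finset.sum_range_succ, hl, hs, hl', hs', mul_add, add_mul,
      Finset.mul_sum, Finset.sum_mul, one_mul, mul_one, ← add_assoc]
    congr 2
    · simp only [mul_assoc]
    · refine Finset.sum_congr rfl fun i hi => ?_
      obtain ⟨j, rfl⟩ := Nat.exists_eq_add_of_lt (Finset.mem_range.1 hi)
      have e : n + (i + j + 1) = n + i + 1 + j := by ring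
      rw [e, hl', hs']
      simp only [mul_assoc]

theorem norm_iterate_two_sided_le {R : Type*} [NormedRing R] {D F U V : ℕ → R}
    {l s : ℕ → ℕ → R} (hD : ∀ n, D (n + 1) = U n * D n * V n + F n)
    (hl : ∀ n, l n n = 1) (hl' : ∀ m k, l m (m + k + 1) = U (m + k) * l m (m + k))
    (hs : ∀ n, s n n = 1) (hs' : ∀ m k, s m (m + k + 1) = s m (m + k) * V (m + k))
    {c q d e : ℝ} (hc : 0 ≤ c) (hq0 : 0 ≤ q) (hq : q < 1) (he : 0 ≤ e)
    (hls : ∀ m k, ‖l m (m + k)‖ * ‖s m (m + k)‖ ≤ c * q ^ k) {n : ℕ} (hd : ‖D n‖ ≤ d)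
    (hF : ∀ i, ‖F (n + i)‖ ≤ e) (k : ℕ) :
    ‖D (n + k)‖ ≤ c * q ^ k * d + c * e / (1 - q) := by
  have hmul : ∀ (m j : ℕ) (T : R) (t : ℝ), ‖T‖ ≤ t →
      ‖l m (m + j) * T * s m (m + j)‖ ≤ c * q ^ j * t := fun m j T t hT =>
    calc ‖l m (m + j) * T * s m (m + j)‖ ≤ ‖l m (m + j)‖ * ‖T‖ * ‖s m (m + j)‖ :=
          (norm_mul_le _ _).trans (by gcongr; exact norm_mul_le _ _)
      _ = (‖l m (m + j)‖ * ‖s m (m + j)‖) * ‖T‖ := by ring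
      _ ≤ c * q ^ j * t := mul_le_mul (hls m j) hT (norm_nonneg _) (by positivity)
  rw [iterate_two_sided hD hl hl' hs hs' n k]
  refine (norm_add_le _ _).trans (add_le_add (hmul n k _ _ hd) ?_)
  calc _ ≤ ∑ i ∈ Finset.range k, c * q ^ (k - 1 - i) * e := by
        refine norm_sum_le_of_le _ fun i hi => ?_
        obtain ⟨j, rfl⟩ := Nat.exists_eq_add_of_lt (Finset.mem_range.1 hi)
        rw [show n + (i + j + 1) = n + i + 1 + j by ring,
          show i + j + 1 - 1 - i = j by omega]
        exact hmul _ _ _ _ (hF i)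
    _ = c * e * ∑ i ∈ Finset.range k, q ^ i := by
        rw [Finset.sum_range_reflect (fun i => c * q ^ i * e) k, Finset.mul_sum]
        exact Finset.sum_congr rfl fun i _ => by ring
    _ ≤ c * e * (1 - q)⁻¹ := by
        gcongr
        rw [← tsum_geometric_of_lt_one hq0 hq]
        exact (summable_geometric_of_lt_one hq0 hq).sum_le_tsum _ fun i _ => by positivity
    _ = c * e / (1 - q) := by rw [div_eq_mul_inv]

variable {r : ℕ}

/-- The last diagonal block of the resolvent at `x` of the truncated block Jacobi matrix. -/
noncomputable def resolventBlock (A p : ℕ → Matrix (Fin r) (Fin r) ℂ) (n : ℕ) :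
    Matrix (Fin r) (Fin r) ℂ :=
  p n * (A (n + 1) * p (n + 1))⁻¹

/-- The propagator `A_m p_m (A_n p_n)⁻¹`, with indices shifted by one. -/
noncomputable def propagator (A p : ℕ → Matrix (Fin r) (Fin r) ℂ) (m n : ℕ) :
    Matrix (Fin r) (Fin r) ℂ :=
  A (m + 1) * p (m + 1) * (A (n + 1) * p (n + 1))⁻¹

/-- A solution of the recurrence at a point at distance at least `δ` from the spectra of all
truncated block Jacobi matrices. -/
structure IsControlled (A B : ℕ → Matrix (Fin r) (Fin r) ℂ) (x : ℂ) (a δ : ℝ)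
    (p : ℕ → Matrix (Fin r) (Fin r) ℂ) : Prop extends IsSolution A B x p where
  isUnit : ∀ n, IsUnit (A (n + 1) * p (n + 1))
  norm_le : ∀ n, ‖A n‖ ≤ a
  sum_le : ∀ (k : ℕ) (v : EuclideanSpace ℂ (Fin r)),
    δ ^ 2 * ∑ j ∈ Finset.range k, ‖Matrix.toEuclideanCLM (𝕜 := ℂ) (p j) v‖ ^ 2 ≤
      ‖Matrix.toEuclideanCLM (𝕜 := ℂ) (A k * p k) v‖ ^ 2

section Controlled

variable {A B p : ℕ → Matrix (Fin r) (Fin r) ℂ} {x : ℂ} {a δ : ℝ}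

theorem IsControlled.norm_resolventBlock_le (hp : IsControlled A B x a δ p) (hδ : 0 < δ) (n : ℕ) :
    ‖resolventBlock A p n‖ ≤ δ⁻¹ := by
  have h : ‖resolventBlock A p n‖ ^ 2 ≤ δ⁻¹ ^ 2 := by
    refine norm_mul_inv_sq_le (hp.isUnit n) (by positivity) fun v => ?_
    rw [inv_pow, inv_mul_eq_div, le_div_iff₀ (by positivity), mul_comm]
    refine le_trans ?_ (hp.sum_le (n + 1) v)
    gcongr
    exact Finset.single_le_sum (f := fun j => ‖Matrix.toEuclideanCLM (𝕜 := ℂ) (p j) v‖ ^ 2)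
      (fun _ _ => by positivity) (Finset.self_mem_range_succ n)
  exact (abs_le_of_sq_le_sq' h (by positivity)).2

theorem IsControlled.norm_propagator_sq_le (hp : IsControlled A B x a δ p) (hδ : 0 < δ)
    (ha : 0 < a) (m i : ℕ) :
    ‖propagator A p m (m + i)‖ ^ 2 ≤
      (2 + a ^ 2 / δ ^ 2) * (a ^ 2 / (a ^ 2 + δ ^ 2)) ^ i := by
  refine norm_mul_inv_sq_le (hp.isUnit _) (by positivity) fun v => ?_
  set f : ℕ → ℝ := fun j => ‖Matrix.toEuclideanCLM (𝕜 := ℂ) (p j) v‖ ^ 2 with hf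
  set g : ℕ → ℝ := fun j => ‖Matrix.toEuclideanCLM (𝕜 := ℂ) (A j * p j) v‖ ^ 2 with hg
  have hgf : ∀ k, g k ≤ a ^ 2 * f k := fun k => by
    simp only [hg, hf]
    rw [← mul_pow, map_mul, mul_apply_eq_comp]
    gcongr
    refine (ContinuousLinearMap.le_opNorm _ _).trans ?_
    gcongr
    exact hp.norm_le k
  have hS : ∀ k, δ ^ 2 * ∑ j ∈ Finset.range k, f j ≤ g k := fun k => hp.sum_le k v
  change g (m + 1) ≤ _ * g (m + i + 1)
  have hgn : 0 ≤ g (m + i + 1) := by positivity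
  cases i with
  | zero =>
    rw [pow_zero, mul_one]
    exact le_mul_of_one_le_left hgn (by linarith [show 0 ≤ a ^ 2 / δ ^ 2 by positivity])
  | succ i =>
    set q := a ^ 2 / (a ^ 2 + δ ^ 2)
    -- Only `i` of the `i + 1` steps gain a factor `q`; the missing one is paid for by `a² / δ² / q
    -- = 1 + a² / δ²`, which the stated constant exceeds.
    have h1 := sum_range_le_pow_mul ha (fun k => (hS k).trans (hgf k)) (m + 2) i
    have h2 : f (m + 1) ≤ ∑ j ∈ Finset.range (m + 2), f j :=
      Finset.single_le_sum (fun _ _ => by positivity) (Finset.self_mem_range_succ _)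
    have h3 := hS (m + 2 + i)
    rw [show m + 2 + i = m + (i + 1) + 1 by ring] at h1 h3
    calc g (m + 1) ≤ a ^ 2 * (q ^ i * (g (m + (i + 1) + 1) / δ ^ 2)) := by
          refine (hgf _).trans ?_
          gcongr
          refine (h2.trans h1).trans ?_
          gcongr
          rw [le_div_iff₀ (by positivity), mul_comm]
          exact h3
      _ = (a ^ 2 / δ ^ 2 / q) * q ^ (i + 1) * g (m + (i + 1) + 1) := by
          have : q ≠ 0 := by positivity
          field_simp
          ring
      _ ≤ _ := by
          gcongr
          have : a ^ 2 / δ ^ 2 / q = 1 + a ^ 2 / δ ^ 2 := by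
            simp only [q]
            field_simp
            ring
          linarith

theorem IsControlled.riccati_zero (hp : IsControlled A B x a δ p) :
    (x • 1 - B 0) * resolventBlock A p 0 = 1 := by
  have h := hp.recurrence 0
  simp only [prev, hp.initial, mul_zero, add_zero, mul_one] at h
  rw [resolventBlock, hp.initial, one_mul, h, add_sub_cancel_right]
  exact Matrix.mul_nonsing_inv _ ((Matrix.isUnit_iff_isUnit_det _).1 (hp.isUnit 0))

/-- Substitute `p n = W_n A_{n+1} p_{n+1}` in the recurrence at `n + 1` and divide on the right by
`A_{n+2} p_{n+2}`. -/
theorem IsControlled.riccati (hp : IsControlled A B x a δ p) (n : ℕ) :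
    (x • 1 - B (n + 1) - (A (n + 1))ᴴ * resolventBlock A p n * A (n + 1)) *
      resolventBlock A p (n + 1) = 1 := by
  have hdet := fun n => (Matrix.isUnit_iff_isUnit_det _).1 (hp.isUnit n)
  have h1 : resolventBlock A p n * A (n + 1) * p (n + 1) = p n := by
    rw [resolventBlock, mul_assoc, Matrix.nonsing_inv_mul_cancel_right _ _ (hdet n)]
  have h := hp.recurrence (n + 1)
  have h2 : (x • 1 - B (n + 1) - (A (n + 1))ᴴ * resolventBlock A p n * A (n + 1)) * p (n + 1) =
      A (n + 2) * p (n + 2) := by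
    simp only [prev] at h
    rw [sub_mul, sub_mul, mul_assoc, mul_assoc, ← mul_assoc _ (A (n + 1)), h1, smul_mul_assoc,
      one_mul, h]
    abel
  rw [resolventBlock.eq_1 A p (n + 1), ← mul_assoc, h2]
  exact Matrix.mul_nonsing_inv _ (hdet (n + 1))

theorem IsControlled.propagator_self (hp : IsControlled A B x a δ p) (n : ℕ) :
    propagator A p n n = 1 :=
  Matrix.mul_nonsing_inv _ ((Matrix.isUnit_iff_isUnit_det _).1 (hp.isUnit n))

theorem IsControlled.propagator_succ (hp : IsControlled A B x a δ p) (m n : ℕ) :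
    propagator A p m (n + 1) =
      propagator A p m n * (A (n + 1) * resolventBlock A p (n + 1)) := by
  rw [propagator, propagator, resolventBlock, ← mul_assoc (A (n + 1)), ← mul_assoc,
    Matrix.nonsing_inv_mul_cancel_right _ _
      ((Matrix.isUnit_iff_isUnit_det _).1 (hp.isUnit n))]

/-- Both sides solve the same Riccati recursion. This turns left products of `W A*` at `x` into
adjoints of propagators at `star x`. -/
theorem IsControlled.conjTranspose_resolventBlock {p' : ℕ → Matrix (Fin r) (Fin r) ℂ}
    (hp : IsControlled A B x a δ p) (hp' : IsControlled A B (star x) a δ p')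
    (hB : ∀ n, (B n).IsHermitian) (n : ℕ) :
    (resolventBlock A p' n)ᴴ = resolventBlock A p n := by
  induction n with
  | zero =>
    have h := congrArg Matrix.conjTranspose hp'.riccati_zero
    simp only [Matrix.conjTranspose_mul, Matrix.conjTranspose_sub, Matrix.conjTranspose_smul,
      star_star, Matrix.conjTranspose_one, (hB 0).eq] at h
    exact left_inv_eq_right_inv h hp.riccati_zero
  | succ n ih =>
    have h := congrArg Matrix.conjTranspose (hp'.riccati n)
    simp only [Matrix.conjTranspose_mul, Matrix.conjTranspose_sub, Matrix.conjTranspose_smul,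
      star_star, Matrix.conjTranspose_one, (hB _).eq, ih, Matrix.conjTranspose_conjTranspose,
      ← mul_assoc] at h
    exact left_inv_eq_right_inv h (hp.riccati n)

/-- The defect in comparing the Riccati recurrence with its shift by `m`. -/
noncomputable def shiftDefect (A B p : ℕ → Matrix (Fin r) (Fin r) ℂ) (m n : ℕ) :
    Matrix (Fin r) (Fin r) ℂ :=
  (A (n + 1))ᴴ * resolventBlock A p n * (A (n + 1) - A (n + m + 1)) +
    (A (n + 1) - A (n + m + 1))ᴴ * resolventBlock A p (n + m) * A (n + m + 1) +
    (B (n + 1) - B (n + m + 1))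

theorem IsControlled.norm_shiftDefect_le (hp : IsControlled A B x a δ p) (hδ : 0 < δ)
    {ε : ℝ} {m n : ℕ} (hA : ‖A (n + 1) - A (n + m + 1)‖ ≤ ε)
    (hB : ‖B (n + 1) - B (n + m + 1)‖ ≤ ε) :
    ‖shiftDefect A B p m n‖ ≤ (2 * (a * δ⁻¹) + 1) * ε := by
  have ha : 0 ≤ a := (norm_nonneg _).trans (hp.norm_le 0)
  have hε : 0 ≤ ε := (norm_nonneg _).trans hA
  have h1 : ‖(A (n + 1))ᴴ * resolventBlock A p n * (A (n + 1) - A (n + m + 1))‖ ≤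
      a * δ⁻¹ * ε := by
    refine (norm_mul_le _ _).trans ?_
    gcongr
    refine (norm_mul_le _ _).trans ?_
    rw [Matrix.l2_opNorm_conjTranspose]
    gcongr
    · exact hp.norm_le _
    · exact hp.norm_resolventBlock_le hδ _
  have h2 : ‖(A (n + 1) - A (n + m + 1))ᴴ * resolventBlock A p (n + m) * A (n + m + 1)‖ ≤
      ε * δ⁻¹ * a := by
    refine (norm_mul_le _ _).trans ?_
    gcongr
    · refine (norm_mul_le _ _).trans ?_
      rw [Matrix.l2_opNorm_conjTranspose]
      gcongr
      exact hp.norm_resolventBlock_le hδ _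
    · exact hp.norm_le _
  calc _ ≤ a * δ⁻¹ * ε + ε * δ⁻¹ * a + ε :=
        (norm_add_le _ _).trans (add_le_add ((norm_add_le _ _).trans (add_le_add h1 h2)) hB)
    _ = _ := by ring

/-- A second resolvent identity: `W - W' = W (W'⁻¹ - W⁻¹) W'`, with the inverses read off from the
Riccati recurrence. -/
theorem IsControlled.resolventBlock_sub_shift (hp : IsControlled A B x a δ p) (m n : ℕ) :
    resolventBlock A p (n + 1) - resolventBlock A p (n + 1 + m) =
      resolventBlock A p (n + 1) * (A (n + 1))ᴴ *
        (resolventBlock A p n - resolventBlock A p (n + m)) *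
        (A (n + m + 1) * resolventBlock A p (n + m + 1)) +
      resolventBlock A p (n + 1) * shiftDefect A B p m n * resolventBlock A p (n + m + 1) := by
  rw [add_right_comm n 1 m]
  have h1 := mul_eq_one_comm.1 (hp.riccati n)
  have h2 := hp.riccati (n + m)
  set W := resolventBlock A p
  calc W (n + 1) - W (n + m + 1) =
        W (n + 1) * ((x • 1 - B (n + m + 1) - (A (n + m + 1))ᴴ * W (n + m) * A (n + m + 1)) *
          W (n + m + 1)) -
        W (n + 1) * (x • 1 - B (n + 1) - (A (n + 1))ᴴ * W n * A (n + 1)) * W (n + m + 1) := by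
        rw [h1, h2, one_mul, mul_one]
    _ = _ := by
        rw [shiftDefect, Matrix.conjTranspose_sub]
        noncomm_ring

theorem IsControlled.norm_resolventBlock_sub_le {p' : ℕ → Matrix (Fin r) (Fin r) ℂ}
    (hp : IsControlled A B x a δ p) (hp' : IsControlled A B (star x) a δ p')
    (hB : ∀ n, (B n).IsHermitian) (hδ : 0 < δ) (ha : 0 < a) {ε : ℝ} {n m : ℕ}
    (hAε : ∀ i, n < i → ‖A i - A (i + m)‖ ≤ ε) (hBε : ∀ i, n < i → ‖B i - B (i + m)‖ ≤ ε) (k : ℕ) :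
    ‖resolventBlock A p (n + k) - resolventBlock A p (n + k + m)‖ ≤
      (2 + a ^ 2 / δ ^ 2) * (a ^ 2 / (a ^ 2 + δ ^ 2)) ^ k * (2 * δ⁻¹) +
      (2 + a ^ 2 / δ ^ 2) * (δ⁻¹ * ((2 * (a * δ⁻¹) + 1) * ε) * δ⁻¹) /
        (1 - a ^ 2 / (a ^ 2 + δ ^ 2)) := by
  have hε : 0 ≤ ε := (norm_nonneg _).trans (hAε (n + 1) (by omega))
  have hW := hp.norm_resolventBlock_le hδ
  refine norm_iterate_two_sided_le
    (D := fun n => resolventBlock A p n - resolventBlock A p (n + m))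
    (U := fun n => resolventBlock A p (n + 1) * (A (n + 1))ᴴ)
    (V := fun n => A (n + m + 1) * resolventBlock A p (n + m + 1))
    (F := fun n => resolventBlock A p (n + 1) * shiftDefect A B p m n *
      resolventBlock A p (n + m + 1))
    (l := fun m n => (propagator A p' m n)ᴴ)
    (s := fun i n => propagator A p (i + m) (n + m))
    (fun n => hp.resolventBlock_sub_shift m n) (fun n => ?_) (fun i n => ?_)
    (fun n => hp.propagator_self _) (fun i n => ?_) (by positivity) (by positivity)
    ?_ (by positivity) (fun i n => ?_) ?_ (fun i => ?_) k
  · simp [hp'.propagator_self]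
  · rw [hp'.propagator_succ, Matrix.conjTranspose_mul, Matrix.conjTranspose_mul,
      hp.conjTranspose_resolventBlock hp' hB]
  · rw [add_right_comm (i + n) 1 m, hp.propagator_succ]
  · rw [div_lt_one (by positivity)]
    linarith [pow_pos hδ 2]
  · rw [Matrix.l2_opNorm_conjTranspose, add_right_comm i n m]
    have h1 := hp'.norm_propagator_sq_le hδ ha i n
    have h2 := hp.norm_propagator_sq_le hδ ha (i + m) n
    -- The product of the two norms is at most the mean of their squares, each bounded by `c q^n`.
    nlinarith [sq_nonneg (‖propagator A p' i (i + n)‖ - ‖propagator A p (i + m) (i + m + n)‖)]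
  · refine (norm_sub_le _ _).trans ?_
    linarith [hW n, hW (n + m)]
  · refine (norm_mul_le _ _).trans ?_
    gcongr
    · refine (norm_mul_le _ _).trans ?_
      gcongr
      · exact hW _
      · refine hp.norm_shiftDefect_le hδ ?_ ?_
        · rw [add_right_comm (n + i) m 1]
          exact hAε _ (by omega)
        · rw [add_right_comm (n + i) m 1]
          exact hBε _ (by omega)
    · exact hW _

end Controlled

end MatrixOP

/-! ### Separating the roots by the unit circle. -/

namespace MatrixOP

open scoped Matrix.Norms.L2Operator Matrix
open Filter Topology

theorem prod_castLE_eq_of_monotone_norm {m n : ℕ} (hmn : m ≤ n) {ζ : Fin n → ℂ}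
    (hζ : Monotone fun k => ‖ζ k‖) {s t : Multiset ℂ}
    (hst : (Finset.univ : Finset (Fin n)).val.map ζ = s + t) (hs : s.card = m)
    (hs1 : ∀ z ∈ s, ‖z‖ < 1) (ht1 : ∀ z ∈ t, 1 ≤ ‖z‖) :
    ∏ k : Fin m, ζ (Fin.castLE hmn k) = s.prod := by
  set F : Finset (Fin n) := Finset.univ.filter fun k => ‖ζ k‖ < 1
  have hF : F.val.map ζ = s := by
    have h := congrArg (Multiset.filter fun z => ‖z‖ < 1) hst
    rw [Multiset.filter_add, Multiset.filter_eq_self.2 hs1,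
      Multiset.filter_eq_nil.2 fun z hz => not_lt.2 (ht1 z hz), add_zero,
      Multiset.filter_map] at h
    exact h
  have hcard : F.card = m := by rw [← hs, ← hF, Multiset.card_map]; rfl
  have hlt : ∀ k ∈ F, (k : ℕ) < m := fun k hk => by
    -- Monotonicity makes `F` an initial segment; having `m` elements, it is exactly the first `m`
    -- indices.
    have hsub : Finset.Iic k ⊆ F := fun j hj => by
      refine Finset.mem_filter.2 ⟨Finset.mem_univ _, ?_⟩
      exact (hζ (Finset.mem_Iic.1 hj)).trans_lt (Finset.mem_filter.1 hk).2
    have := Finset.card_le_card hsub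
    rw [Fin.card_Iic] at this
    omega
  have hF' : F = Finset.univ.map (Fin.castLEEmb hmn) := by
    refine Finset.eq_of_subset_of_card_le (fun k hk => ?_) (by simp [hcard])
    exact Finset.mem_map.2 ⟨⟨k, hlt k hk⟩, Finset.mem_univ _, rfl⟩
  have h2 : ∏ k ∈ F, ζ k = s.prod := by rw [← hF]; rfl
  rw [← h2, hF', Finset.prod_map]
  rfl

variable {r : ℕ}

/-- A kernel vector would be fixed by every `(z T)^k`, and these tend to 0. -/
theorem det_one_sub_smul_ne_zero {T : Matrix (Fin r) (Fin r) ℂ}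
    (hT : Tendsto (fun k => T ^ k) atTop (𝓝 0)) {z : ℂ} (hz : ‖z‖ ≤ 1) :
    (1 - z • T).det ≠ 0 := by
  intro h
  obtain ⟨v, hv, h⟩ := Matrix.exists_mulVec_eq_zero_iff.2 h
  rw [Matrix.sub_mulVec, Matrix.one_mulVec, sub_eq_zero] at h
  have hk : ∀ k : ℕ, (z ^ k • T ^ k) *ᵥ v = v := fun k => by
    rw [← _root_.smul_pow]
    induction k with
    | zero => simp
    | succ k ih => rw [pow_succ, ← Matrix.mulVec_mulVec, ← h, ih]
  have h0 : Tendsto (fun k => z ^ k • T ^ k) atTop (𝓝 0) := by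
    rw [tendsto_zero_iff_norm_tendsto_zero] at hT ⊢
    refine squeeze_zero (fun _ => norm_nonneg _) (fun k => ?_) hT
    rw [norm_smul, norm_pow]
    exact mul_le_of_le_one_left (norm_nonneg _) (pow_le_one₀ (norm_nonneg _) hz)
  have h1 : Tendsto (fun k => (z ^ k • T ^ k) *ᵥ v) atTop (𝓝 (0 *ᵥ v)) :=
    ((continuous_id.matrix_mulVec continuous_const).tendsto _).comp h0
  simp only [hk, Matrix.zero_mulVec] at h1
  exact hv (tendsto_nhds_unique tendsto_const_nhds h1)

/-- A solvent of the quadratic matrix polynomial yields a factorization of its determinant. -/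
theorem fPoly_eq_mul_charpoly {A B W : Matrix (Fin r) (Fin r) ℂ} {x : ℂ}
    (hW : (x • 1 - B - Aᴴ * W * A) * W = 1) :
    fPoly A B x = ((X : ℂ[X]) • Aᴴ.map C - (x • 1 - B - Aᴴ * W * A).map C).det *
      (W * A).charpoly := by
  rw [fPoly, Matrix.charpoly, ← Matrix.det_mul]
  congr 1
  -- Since `V W = 1`, the quadratic pencil is `(Z A* - V)(Z - W A)`.
  set V := x • 1 - B - Aᴴ * W * A with hV
  have hBx : B - x • 1 = -(V + Aᴴ * (W * A)) := by rw [hV, ← mul_assoc]; abel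
  have hA : A = V * (W * A) := by rw [← mul_assoc, hW, one_mul]
  have hch : (W * A).charmatrix = (X : ℂ[X]) • (1 : Matrix (Fin r) (Fin r) ℂ[X]) -
      (W * A).map C := by
    rw [Matrix.charmatrix, Matrix.scalar_apply, Matrix.smul_one_eq_diagonal]
    rfl
  have hmul : ∀ S T : Matrix (Fin r) (Fin r) ℂ, (S * T).map C = S.map C * T.map C := fun S T =>
    Matrix.map_mul
  have hneg : ∀ S : Matrix (Fin r) (Fin r) ℂ, (-S).map C = -S.map C := fun S => by ext; simp
  have hadd : ∀ S T : Matrix (Fin r) (Fin r) ℂ, (S + T).map C = S.map C + T.map C := fun S T =>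
    Matrix.map_add _ (fun _ _ => C_add) _ _
  rw [hBx, hneg, hadd, hmul Aᴴ, hch]
  conv_lhs => rw [show A.map C = V.map C * (W * A).map C by rw [← hmul, ← hA]]
  simp only [sub_mul, mul_sub, smul_mul_assoc, mul_smul_comm, mul_one, smul_neg, smul_add,
    smul_sub, pow_two, mul_smul]
  abel

/-- The product of the `r` smallest roots, in terms of a solvent with small spectrum. -/
theorem IsRootLabelling.prod_eq_det {A B W : Matrix (Fin r) (Fin r) ℂ} {x : ℂ} (hr : 1 ≤ r)
    (hW : (x • 1 - B - Aᴴ * W * A) * W = 1)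
    (h1 : Tendsto (fun k => (A * W) ^ k) atTop (𝓝 0))
    (h2 : Tendsto (fun k => (W * Aᴴ) ^ k) atTop (𝓝 0)) {ζ : Fin (2 * r) → ℂ}
    (hζ : IsRootLabelling A B x ζ) (hle : r ≤ 2 * r) :
    ∏ k : Fin r, ζ (Fin.castLE hle k) = (W * A).det := by
  rw [Matrix.det_eq_prod_roots_charpoly]
  have hf : fPoly A B x ≠ 0 := by
    -- The zero polynomial has an empty root multiset, whereas the labelling supplies `2 * r > 0`
    -- roots.
    intro h
    have := congrArg Multiset.card hζ.roots_eq
    simp [h] at this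
    omega
  have hroots := hζ.roots_eq
  rw [fPoly_eq_mul_charpoly hW] at hf hroots
  rw [roots_mul hf, add_comm] at hroots
  refine prod_castLE_eq_of_monotone_norm hle hζ.norm_mono hroots ?_ ?_ ?_
  · rw [← (IsAlgClosed.splits (W * A).charpoly).natDegree_eq_card_roots,
      Matrix.charpoly_natDegree_eq_dim, Fintype.card_fin]
  · intro z hz
    have hz := (mem_roots'.1 hz).2
    by_contra! hz1
    have hz0 : z ≠ 0 := by rintro rfl; simp at hz1; linarith
    rw [IsRoot, Matrix.eval_charpoly] at hz
    have h3 : Matrix.scalar (Fin r) z - W * A = z • (1 - z⁻¹ • W * A) := by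
      rw [smul_sub, smul_mul_assoc, smul_inv_smul₀ hz0, Matrix.scalar_apply,
        Matrix.smul_one_eq_diagonal]
    rw [h3, Matrix.det_smul, Matrix.det_one_sub_mul_comm, mul_smul_comm] at hz
    refine det_one_sub_smul_ne_zero h1 (z := z⁻¹) ?_
      ((mul_eq_zero.1 hz).resolve_left (pow_ne_zero _ hz0))
    rw [norm_inv]
    exact inv_le_one_of_one_le₀ hz1
  · intro z hz
    have hz := (mem_roots'.1 hz).2
    by_contra! hz1
    rw [IsRoot, ← coe_evalRingHom, RingHom.map_det] at hz
    have h3 : (evalRingHom z).mapMatrix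
        ((X : ℂ[X]) • Aᴴ.map C - (x • 1 - B - Aᴴ * W * A).map C) =
        z • Aᴴ - (x • 1 - B - Aᴴ * W * A) := by
      ext i j
      simp only [RingHom.mapMatrix_apply, Matrix.map_apply, Matrix.sub_apply, Matrix.smul_apply,
        smul_eq_mul, coe_evalRingHom, eval_sub, eval_mul, eval_X, eval_C]
    rw [h3] at hz
    refine det_one_sub_smul_ne_zero h2 hz1.le ?_
    -- Multiplying the first factor by `W = V⁻¹` reduces it to `z W A* - 1`.
    have h4 : 1 - z • (W * Aᴴ) = -(W * (z • Aᴴ - (x • 1 - B - Aᴴ * W * A))) := by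
      rw [mul_sub, mul_eq_one_comm.1 hW, mul_smul_comm]
      abel
    rw [h4, Matrix.det_neg, Matrix.det_mul, hz, mul_zero, mul_zero]

/-! ### Uniform convergence of the resolvent blocks. -/

section Limit

variable {An Bn : ℕ → Matrix (Fin r) (Fin r) ℂ} {A B : Matrix (Fin r) (Fin r) ℂ} {a δ : ℝ}

theorem uniformCauchySeqOn_resolventBlock (hBn : ∀ n, (Bn n).IsHermitian)
    (hA : CauchySeq An) (hB : CauchySeq Bn) (ha : 0 < a) (hδ : 0 < δ) {S : Set ℂ}
    (hS : ∀ x ∈ S, star x ∈ S) {p : ℂ → ℕ → Matrix (Fin r) (Fin r) ℂ}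
    (hp : ∀ x ∈ S, IsControlled An Bn x a δ (p x)) :
    UniformCauchySeqOn (fun n x => resolventBlock An (p x) n) atTop S := by
  have key : ∀ ε > 0, ∃ N, ∀ m, ∀ x ∈ S,
      ‖resolventBlock An (p x) N - resolventBlock An (p x) (N + m)‖ < ε := by
    intro ε hε
    set q := a ^ 2 / (a ^ 2 + δ ^ 2) with hq
    have hq0 : 0 ≤ q := by positivity
    have hq1 : q < 1 := by
      rw [hq, div_lt_one (by positivity)]
      linarith [pow_pos hδ 2]
    set c := 2 + a ^ 2 / δ ^ 2
    have hlim1 : Tendsto (fun k : ℕ => c * q ^ k * (2 * δ⁻¹)) atTop (𝓝 0) := by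
      have := ((tendsto_pow_atTop_nhds_zero_of_lt_one hq0 hq1).const_mul c).mul_const (2 * δ⁻¹)
      simpa using this
    have hlim2 : Tendsto (fun η : ℝ => c * (δ⁻¹ * ((2 * (a * δ⁻¹) + 1) * η) * δ⁻¹) / (1 - q))
        (𝓝[>] 0) (𝓝 0) := by
      have : Continuous fun η : ℝ => c * (δ⁻¹ * ((2 * (a * δ⁻¹) + 1) * η) * δ⁻¹) / (1 - q) := by
        fun_prop
      have := this.tendsto 0
      simp only [mul_zero, zero_mul, zero_div] at this
      exact this.mono_left nhdsWithin_le_nhds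
    -- `k` kills the transient and `η` the forcing; neither depends on `x`, which makes the estimate
    -- uniform.
    obtain ⟨k, hk⟩ := (hlim1.eventually_lt_const (half_pos hε)).exists
    obtain ⟨η, hη, hη0⟩ := ((hlim2.eventually_lt_const (half_pos hε)).and
      self_mem_nhdsWithin).exists
    obtain ⟨N₁, hN₁⟩ := Metric.cauchySeq_iff.1 hA η hη0
    obtain ⟨N₂, hN₂⟩ := Metric.cauchySeq_iff.1 hB η hη0
    refine ⟨max N₁ N₂ + k, fun m x hx => ?_⟩
    refine ((hp x hx).norm_resolventBlock_sub_le (hp _ (hS x hx)) hBn hδ ha (ε := η)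
      (fun i hi => ?_) (fun i hi => ?_) k).trans_lt (by linarith)
    · rw [← dist_eq_norm]
      exact (hN₁ i (by omega) (i + m) (by omega)).le
    · rw [← dist_eq_norm]
      exact (hN₂ i (by omega) (i + m) (by omega)).le
  rw [Metric.uniformCauchySeqOn_iff]
  intro ε hε
  obtain ⟨N, hN⟩ := key (ε / 2) (half_pos hε)
  refine ⟨N, fun m hm n hn x hx => ?_⟩
  obtain ⟨i, rfl⟩ := Nat.exists_eq_add_of_le hm
  obtain ⟨j, rfl⟩ := Nat.exists_eq_add_of_le hn
  calc _ ≤ dist (resolventBlock An (p x) (N + i)) (resolventBlock An (p x) N) +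
        dist (resolventBlock An (p x) N) (resolventBlock An (p x) (N + j)) := dist_triangle _ _ _
    _ < ε / 2 + ε / 2 := by
        rw [dist_comm, dist_eq_norm, dist_eq_norm]
        exact add_lt_add (hN i x hx) (hN j x hx)
    _ = ε := add_halves ε

theorem IsControlled.riccati_of_tendsto {x : ℂ} {p : ℕ → Matrix (Fin r) (Fin r) ℂ}
    (hp : IsControlled An Bn x a δ p) (hA : Tendsto An atTop (𝓝 A)) (hB : Tendsto Bn atTop (𝓝 B))
    {W : Matrix (Fin r) (Fin r) ℂ} (hW : Tendsto (resolventBlock An p) atTop (𝓝 W)) :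
    (x • 1 - B - Aᴴ * W * A) * W = 1 := by
  have hA' := (tendsto_add_atTop_iff_nat 1).2 hA
  have hB' := (tendsto_add_atTop_iff_nat 1).2 hB
  have hW' := (tendsto_add_atTop_iff_nat 1).2 hW
  have hAs : Tendsto (fun n => (An (n + 1))ᴴ) atTop (𝓝 Aᴴ) :=
    (continuous_id.matrix_conjTranspose.tendsto A).comp hA'
  have h := ((hB'.const_sub (x • 1)).sub ((hAs.mul hW).mul hA')).mul hW'
  simp only [hp.riccati] at h
  exact tendsto_nhds_unique h tendsto_const_nhds

/-- A propagator over `k` steps is a product of `k` consecutive `A_i W_i`, so it tends to `(A W)^k`,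
which inherits the geometric bound. -/
theorem IsControlled.tendsto_mul_pow {x : ℂ} {p : ℕ → Matrix (Fin r) (Fin r) ℂ}
    (hp : IsControlled An Bn x a δ p) (hδ : 0 < δ) (ha : 0 < a) (hA : Tendsto An atTop (𝓝 A))
    {W : Matrix (Fin r) (Fin r) ℂ} (hW : Tendsto (resolventBlock An p) atTop (𝓝 W)) :
    Tendsto (fun k => (A * W) ^ k) atTop (𝓝 0) := by
  have hprop : ∀ k, Tendsto (fun n => propagator An p n (n + k)) atTop (𝓝 ((A * W) ^ k)) := by
    intro k
    induction k with
    | zero => simp [hp.propagator_self]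
    | succ k ih =>
      simp only [← add_assoc, hp.propagator_succ, pow_succ]
      refine ih.mul (Tendsto.mul ?_ ?_)
      · exact (tendsto_add_atTop_iff_nat (k + 1)).2 hA
      · exact (tendsto_add_atTop_iff_nat (k + 1)).2 hW
  have hle : ∀ k, ‖(A * W) ^ k‖ ^ 2 ≤ (2 + a ^ 2 / δ ^ 2) * (a ^ 2 / (a ^ 2 + δ ^ 2)) ^ k :=
    fun k => le_of_tendsto' ((hprop k).norm.pow 2) fun n => hp.norm_propagator_sq_le hδ ha n k
  have hq1 : a ^ 2 / (a ^ 2 + δ ^ 2) < 1 := by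
    rw [div_lt_one (by positivity)]
    linarith [pow_pos hδ 2]
  have h0 : Tendsto (fun k => ‖(A * W) ^ k‖ ^ 2) atTop (𝓝 0) := by
    refine squeeze_zero (fun _ => by positivity) hle ?_
    simpa using (tendsto_pow_atTop_nhds_zero_of_lt_one (by positivity) hq1).const_mul
      (2 + a ^ 2 / δ ^ 2)
  rw [tendsto_zero_iff_norm_tendsto_zero]
  simpa using h0.sqrt

end Limit

theorem Generates.isControlled {An Bn : ℕ → Matrix (Fin r) (Fin r) ℂ}
    {P : ℕ → Matrix (Fin r) (Fin r) ℂ[X]} (hP : Generates An Bn P)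
    (hAn : ∀ n, 1 ≤ n → IsUnit (An n)) (hBn : ∀ n, (Bn n).IsHermitian) {S : Set ℂ}
    (hzeros : ∀ (n : ℕ) (x : ℂ), (P n).det.IsRoot x → x ∈ S) {a : ℝ} (ha : ∀ n, ‖An n‖ ≤ a)
    {x : ℂ} {δ : ℝ} (hδ : 0 < δ) (hx : ∀ t ∈ S, δ ≤ ‖x - t‖) :
    IsControlled An Bn x a δ fun n => (P n).map (eval x) where
  toIsSolution := hP.isSolution x
  isUnit n := by
    refine (hAn (n + 1) (by omega)).mul ((Matrix.isUnit_iff_isUnit_det _).2 ?_)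
    rw [← eval_det, isUnit_iff_ne_zero]
    intro h
    have := hx x (hzeros (n + 1) x h)
    rw [sub_self, norm_zero] at this
    linarith
  norm_le := ha
  sum_le := hP.sum_norm_sq_le hAn hBn hzeros hδ.le hx

end MatrixOP

/-! ### Assembling the ratio asymptotics. -/

open scoped Matrix.Norms.L2Operator Matrix in
open MatrixOP Filter Topology in
/-- Ratio asymptotics on compact sets off an interval containing all zeros. -/
theorem MatrixOP.tendstoUniformlyOn_det_div_det {r : ℕ} (hr : 1 ≤ r)
    (An Bn : ℕ → Matrix (Fin r) (Fin r) ℂ)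
    (hAn : ∀ n, 1 ≤ n → IsUnit (An n)) (hBn : ∀ n, (Bn n).IsHermitian)
    (P : ℕ → Matrix (Fin r) (Fin r) ℂ[X]) (hP : MatrixOP.Generates An Bn P)
    (A B : Matrix (Fin r) (Fin r) ℂ)
    (hAlim : Filter.Tendsto An Filter.atTop (nhds A))
    (hBlim : Filter.Tendsto Bn Filter.atTop (nhds B))
    (M : ℝ)
    (hzeros : ∀ (n : ℕ) (x : ℂ), (P n).det.IsRoot x → x ∈ MatrixOP.interval M)
    (z : ℂ → Fin (2 * r) → ℂ) (hz : ∀ x, MatrixOP.IsRootLabelling A B x (z x))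
    (K : Set ℂ) (hK : IsCompact K) (hKM : K ⊆ (MatrixOP.interval M)ᶜ) :
    TendstoUniformlyOn
      (fun (n : ℕ) (x : ℂ) => (P n).det.eval x / (P (n + 1)).det.eval x)
      (fun x => ∏ k : Fin r, z x (Fin.castLE (Nat.le_mul_of_pos_left r two_pos) k))
      Filter.atTop K := by
  have hI : IsCompact (interval M) := isCompact_Icc.image Complex.continuous_ofReal
  obtain ⟨δ, hδ, hKδ⟩ : ∃ δ > 0, ∀ x ∈ K, ∀ t ∈ interval M, δ ≤ ‖x - t‖ := by
    obtain ⟨δ, hδ, h⟩ := (disjoint_compl_left.mono_left hKM).exists_thickenings hK hI.isClosed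
    refine ⟨δ, hδ, fun x hx t ht => ?_⟩
    by_contra! hlt
    refine Set.disjoint_left.1 h (Metric.self_subset_thickening hδ K hx)
      (Metric.mem_thickening_iff.2 ⟨t, ht, ?_⟩)
    rwa [dist_eq_norm]
  obtain ⟨a, ha, haA⟩ : ∃ a > 0, ∀ n, ‖An n‖ ≤ a := by
    obtain ⟨a, ha⟩ := (Metric.isBounded_range_of_tendsto An hAlim).exists_norm_le
    exact ⟨max a 1, by positivity, fun n => (ha _ ⟨n, rfl⟩).trans (le_max_left _ _)⟩
  set S : Set ℂ := {x | ∀ t ∈ interval M, δ ≤ ‖x - t‖}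
  have hstar : ∀ x ∈ S, star x ∈ S := by
    rintro x hx _ ⟨t, ht, rfl⟩
    have h := hx _ ⟨t, ht, rfl⟩
    rw [← norm_star] at h
    simpa using h
  set p : ℂ → ℕ → Matrix (Fin r) (Fin r) ℂ := fun x n => (P n).map (eval x)
  have hp : ∀ x ∈ S, IsControlled An Bn x a δ (p x) := fun x hx =>
    hP.isControlled hAn hBn hzeros haA hδ hx
  have hunif := uniformCauchySeqOn_resolventBlock hBn hAlim.cauchySeq hBlim.cauchySeq ha hδ
    hstar hp
  have hex : ∀ x, ∃ W, x ∈ S → Tendsto (resolventBlock An (p x)) atTop (𝓝 W) := fun x => by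
    by_cases hx : x ∈ S
    · obtain ⟨W, hW⟩ := cauchySeq_tendsto_of_complete (hunif.cauchySeq hx)
      exact ⟨W, fun _ => hW⟩
    · exact ⟨0, fun h => absurd h hx⟩
  choose W hW using hex
  have hWu : TendstoUniformlyOn (fun n x => resolventBlock An (p x) n) W atTop K :=
    (hunif.tendstoUniformlyOn_of_tendsto hW).mono hKδ
  have hprod : ∀ x ∈ K, ∏ k : Fin r, z x (Fin.castLE (Nat.le_mul_of_pos_left r two_pos) k) =
      (W x * A).det := by
    intro x hxK
    have hx : x ∈ S := hKδ x hxK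
    refine (hz x).prod_eq_det hr ((hp x hx).riccati_of_tendsto hAlim hBlim (hW x hx))
      ((hp x hx).tendsto_mul_pow hδ ha hAlim (hW x hx)) ?_ _
    -- Powers of `W A*` at `x` are adjoints of powers of `A W` at `star x`, which already tend to 0.
    have hWs : (W (star x))ᴴ = W x := by
      refine tendsto_nhds_unique ?_ (hW x hx)
      have := (continuous_id.matrix_conjTranspose.tendsto (W (star x))).comp
        (hW _ (hstar x hx))
      refine this.congr fun n => ?_
      exact (hp x hx).conjTranspose_resolventBlock (hp _ (hstar x hx)) hBn n
    have h := (hp _ (hstar x hx)).tendsto_mul_pow hδ ha hAlim (hW _ (hstar x hx))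
    have h' := (continuous_id.matrix_conjTranspose.tendsto _).comp h
    rw [id, Matrix.conjTranspose_zero] at h'
    refine h'.congr fun k => ?_
    simp only [Function.comp, id, Matrix.conjTranspose_pow, Matrix.conjTranspose_mul, hWs]
  have hratio : ∀ n, ∀ x ∈ K, (resolventBlock An (p x) n).det * (An (n + 1)).det =
      (P n).det.eval x / (P (n + 1)).det.eval x := by
    intro n x hxK
    have h1 : (An (n + 1)).det ≠ 0 :=
      ((Matrix.isUnit_iff_isUnit_det _).1 (hAn (n + 1) (by omega))).ne_zero
    rw [resolventBlock, Matrix.det_mul, Matrix.det_nonsing_inv, Matrix.det_mul, eval_det, eval_det,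
      Ring.inverse_eq_inv', mul_inv]
    change (p x n).det * _ * _ = (p x n).det / (p x (n + 1)).det
    field_simp
  have hAu : TendstoUniformlyOn (fun n (_ : ℂ) => An (n + 1)) (fun _ => A) atTop K := by
    rw [Metric.tendstoUniformlyOn_iff]
    intro ε hε
    filter_upwards [(tendsto_add_atTop_iff_nat 1).2 hAlim |>.eventually (Metric.ball_mem_nhds A hε)]
      with n hn x _
    rw [dist_comm]
    exact hn
  -- The determinant is uniformly continuous only on bounded sets; all the pairs stay in this
  -- compact product.
  set R := Metric.closedBall (0 : Matrix (Fin r) (Fin r) ℂ) δ⁻¹ ×ˢ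
    Metric.closedBall (0 : Matrix (Fin r) (Fin r) ℂ) a
  have hR : IsCompact R := (isCompact_closedBall _ _).prod (isCompact_closedBall _ _)
  have hcont : UniformContinuousOn
      (fun T : Matrix (Fin r) (Fin r) ℂ × Matrix (Fin r) (Fin r) ℂ => T.1.det * T.2.det) R :=
    hR.uniformContinuousOn_of_continuous
      (continuous_fst.matrix_det.mul continuous_snd.matrix_det).continuousOn
  have hmem : ∀ n, ∀ x ∈ K, (resolventBlock An (p x) n, An (n + 1)) ∈ R := fun n x hx =>
    ⟨mem_closedBall_zero_iff.2 ((hp x (hKδ x hx)).norm_resolventBlock_le hδ n),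
      mem_closedBall_zero_iff.2 (haA _)⟩
  have hmem' : ∀ x ∈ K, (W x, A) ∈ R := fun x hx =>
    hR.isClosed.mem_of_tendsto ((hW x (hKδ x hx)).prodMk_nhds
      ((tendsto_add_atTop_iff_nat 1).2 hAlim)) (Eventually.of_forall fun n => hmem n x hx)
  have hpair : TendstoUniformlyOn (fun n x => (resolventBlock An (p x) n, An (n + 1)))
      (fun x => (W x, A)) atTop K := fun u hu =>
    (tendsto_id.prodMk tendsto_id).eventually (hWu.prodMk hAu u hu)
  have hfinal := hcont.comp_tendstoUniformlyOn_eventually (Eventually.of_forall hmem) hmem' hpair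
  refine (hfinal.congr (Eventually.of_forall fun n x hx => hratio n x hx)).congr_right
    fun x hx => ?_
  rw [hprod x hx, Matrix.det_mul]

theorem corollary2p4 {r : ℕ} (hr : 1 ≤ r)
    (An Bn : ℕ → Matrix (Fin r) (Fin r) ℂ)
    (hAn : ∀ n, 1 ≤ n → IsUnit (An n)) (hBn : ∀ n, (Bn n).IsHermitian)
    (P : ℕ → Matrix (Fin r) (Fin r) ℂ[X]) (hP : MatrixOP.Generates An Bn P)
    (A B : Matrix (Fin r) (Fin r) ℂ) (hA : IsUnit A) (hB : B.IsHermitian)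
    (hAlim : Filter.Tendsto An Filter.atTop (nhds A))
    (hBlim : Filter.Tendsto Bn Filter.atTop (nhds B))
    (M : ℝ) (hM : 0 < M)
    (hzeros : ∀ (n : ℕ) (x : ℂ), (P n).det.IsRoot x → x ∈ MatrixOP.interval M)
    (z : ℂ → Fin (2 * r) → ℂ) (hz : ∀ x, MatrixOP.IsRootLabelling A B x (z x))
    (K : Set ℂ) (hK : IsCompact K) (hKM : K ⊆ (MatrixOP.interval M)ᶜ) :
    TendstoUniformlyOn
      (fun (n : ℕ) (x : ℂ) => (P n).det.eval x / (P (n + 1)).det.eval x)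
      (fun x => ∏ k : Fin r, z x (Fin.castLE (Nat.le_mul_of_pos_left r two_pos) k))
      Filter.atTop K := by
  exact MatrixOP.tendstoUniformlyOn_det_div_det hr An Bn hAn hBn P hP A B hAlim hBlim M hzeros z
    hz K hK hKM
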